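/- Let $G$ be a discrete group. A compact Hausdorff $G$-space is a non-empty compact Hausdorff space on which $G$ acts by homeomorphisms; $P(X)$ denotes the set of regular Borel probability measures on such a space $X$, with the weak* topology and the action $(s\nu)(Y)=\nu(s^{-1}Y)$. A $G$-boundary is a compact Hausdorff $G$-space $X$ such that every orbit $Gx$, $x\in X$, is dense in $X$, and such that for every $\nu\in P(X)$ the weak* closure of the orbit $G\nu$ contains a point mass. The Furstenberg boundary $\partial_F G$ is the universal $G$-boundary, i.e. the $G$-boundary (unique up to equivariant homeomorphism) of which every $G$-boundary is a continuous $G$-equivariant image. Let $G$ act on the algebra $C(\partial_F G)$ of continuous complex functions by $(sf)(x)=f(s^{-1}x)$ and on $\ell^\infty(G)$ by $(s\varphi)(t)=\varphi(s^{-1}t)$. For $\nu\in P(\partial_F G)$ the Poisson map $P_\nu\colon C(\partial_F G)\to\ell^\infty(G)$ is $$P_\nu(f)(s)=\int_{\partial_F G} f(sx)\,d\nu(x),\qquad s\in G .$$ An isometric $G$-equivariant copy of $C(\partial_F G)$ in $\ell^\infty(G)$ is the image $\psi(C(\partial_F G))$ of an isometric $G$-equivariant linear map $\psi\colon C(\partial_F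 G)\to\ell^\infty(G)$. Then the map $\nu\mapsto P_\nu(C(\partial_F G))$ is a bijection from $P(\partial_F G)$ onto the collection of isometric $G$-equivariant copies of $C(\partial_F G)$ in $\ell^\infty(G)$. Moreover, for $\nu\in P(\partial_F G)$, the image $P_\nu(C(\partial_F G))$ is a C*-subalgebra of $\ell^\infty(G)$ if and only if $\nu$ is a point mass. -/

import Mathlib

open MeasureTheory Set Topology
open scoped ENNReal

universe u v

noncomputable section

namespace FurstenbergCopies

section Measures

variable (G : Type u) [Group G] (X : Type v) [TopologicalSpace X] [MeasurableSpace X]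
  [BorelSpace X] [MulAction G X] [ContinuousConstSMul G X]

/-- The set `P(X)` of regular Borel probability measures on `X`. Its weak* topology is the one
that Mathlib puts on `ProbabilityMeasure X` (convergence of integrals of bounded continuous
functions). -/
def regularProb (X : Type v) [TopologicalSpace X] [MeasurableSpace X] :
    Set (ProbabilityMeasure X) :=
  {ν | (ν : Measure X).Regular}

variable {G X} in
/-- The action of `G` on measures: `(s ν)(Y) = ν(s⁻¹ Y)`, the push-forward under `x ↦ s x`. -/
def translateMeasure (s : G) (ν : ProbabilityMeasure X) : ProbabilityMeasure X :=
  ν.map (f := fun x : X => s • x) (continuous_const_smul s).measurable.aemeasurable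

/-- The action is minimal: every orbit is dense. -/
def IsMinimalAction (G : Type u) [Group G] (X : Type v) [TopologicalSpace X] [MulAction G X] :
    Prop :=
  ∀ x : X, Dense (MulAction.orbit G x)

/-- The action is strongly proximal: for every `ν ∈ P(X)` the weak* closure of the orbit `G ν`
contains a point mass. -/
def IsStronglyProximal : Prop :=
  ∀ ν ∈ regularProb X, ∃ x : X,
    diracProba x ∈ closure (Set.range fun s : G => translateMeasure s ν)

/-- A `G`-boundary: a non-empty compact Hausdorff `G`-space whose action is minimal and strongly
proximal. -/
structure IsBoundary : Prop where
  nonempty : Nonempty X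
  compactSpace : CompactSpace X
  t2Space : T2Space X
  minimal : IsMinimalAction G X
  stronglyProximal : IsStronglyProximal G X

/-- `X` is the Furstenberg boundary of `G`: it is a `G`-boundary, and it is universal in the sense
that every `G`-boundary is a continuous `G`-equivariant image of it. As every `G`-boundary is a
quotient of the Stone-Cech compactification of `G`, it is no restriction to let `B` range over the
universe of `G`. -/
structure IsFurstenbergBoundary : Prop where
  isBoundary : IsBoundary G X
  universal : ∀ (B : Type u) [TopologicalSpace B] [MeasurableSpace B] [BorelSpace B]
    [MulAction G B] [ContinuousConstSMul G B], IsBoundary G B →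
      ∃ p : X → B, Continuous p ∧ Function.Surjective p ∧ ∀ (s : G) (x : X), p (s • x) = s • p x

end Measures

/-- The C*-algebra `ℓ^∞(G)` of bounded complex functions on `G`, with the supremum norm and
pointwise operations. -/
abbrev LInf (G : Type u) : Type u := lp (fun _ : G => ℂ) ∞

/-- The action of `G` on `C(X)`: `(s f)(x) = f(s⁻¹ x)`. -/
def translateC {G : Type u} [Group G] {X : Type v} [TopologicalSpace X] [MulAction G X]
    [ContinuousConstSMul G X] (s : G) (f : C(X, ℂ)) : C(X, ℂ) :=
  ⟨fun x => f (s⁻¹ • x), f.continuous.comp (continuous_const_smul s⁻¹)⟩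

/-- The action of `G` on `ℓ^∞(G)`: `(s φ)(t) = φ(s⁻¹ t)`. -/
def translateLInf {G : Type u} [Group G] (s : G) (φ : LInf G) : LInf G :=
  ⟨fun t => φ (s⁻¹ * t), by
    apply memℓp_infty
    refine ⟨‖φ‖, ?_⟩
    rintro _ ⟨t, rfl⟩
    exact lp.norm_apply_le_norm ENNReal.top_ne_zero φ (s⁻¹ * t)⟩

section Poisson

variable {G : Type u} [Group G] {X : Type v} [TopologicalSpace X] [CompactSpace X]
  [MeasurableSpace X] [MulAction G X]

/-- The Poisson map `P_ν : C(X) → ℓ^∞(G)`, `P_ν(f)(s) = ∫ f(s x) dν(x)`. -/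
def poissonMap (ν : ProbabilityMeasure X) (f : C(X, ℂ)) : LInf G :=
  ⟨fun s => ∫ x, f (s • x) ∂(ν : Measure X), by
    apply memℓp_infty
    refine ⟨‖f‖, ?_⟩
    rintro _ ⟨s, rfl⟩
    simpa using norm_integral_le_of_norm_le_const (μ := (ν : Measure X)) (C := ‖f‖)
      (Filter.Eventually.of_forall fun x => f.norm_coe_le_norm (s • x))⟩

/-- `S` is an isometric `G`-equivariant copy of `C(X)` in `ℓ^∞(G)`: the image of `C(X)` under
an isometric `G`-equivariant linear map. -/
def IsEquivariantCopy [ContinuousConstSMul G X] (S : Set (LInf G)) : Prop :=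
  ∃ ψ : C(X, ℂ) →ₗᵢ[ℂ] LInf G,
    (∀ (s : G) (f : C(X, ℂ)), ψ (translateC s f) = translateLInf s (ψ f)) ∧ Set.range ψ = S

end Poisson

/-- `S` is a C*-subalgebra of `ℓ^∞(G)`: a norm-closed `*`-subalgebra. -/
def IsCStarSubalgebra {G : Type u} (S : Set (LInf G)) : Prop :=
  ∃ A : NonUnitalStarSubalgebra ℂ (LInf G), IsClosed (A : Set (LInf G)) ∧ (A : Set (LInf G)) = S

end FurstenbergCopies

end

open scoped CompactlySupported

namespace FurstenbergCopies

/-! ### Regular probability measures on a compact space -/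

section Measures

variable {X : Type v} [TopologicalSpace X] [CompactSpace X] [MeasurableSpace X] [BorelSpace X]

/-! Minimality and strong proximality together let translates of any regular `ν` concentrate near
any prescribed point `x`, so `P_ν f` takes values arbitrarily close to `f x`. Applied to the average
of two measures, this gives one group element that works for both, and for finitely many functions
at once (`IsBoundary.exists_poissonMap_close`). Everything on the Poisson side follows by
approximation. `P_ν` is isometric. If `P_μ f = P_ν g` then `f = g`, so the range determines `ν`. If
`P_ν h = P_ν f * P_ν g` then `h = f * g`, so a range that is an algebra makes `ν` multiplicative,
hence a point mass.

For surjectivity, an equivariant isometry `ψ` is determined by the functional `f ↦ ψ f 1`. Up to a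
unimodular scalar, which does not change the range, this functional is a state and so comes from a
measure (`exists_range_poissonMap_eq`). -/

lemma integrable_continuousMap {E : Type*} [NormedAddCommGroup E]
    [SecondCountableTopologyEither X E] (μ : Measure X) [IsFiniteMeasure μ] (f : C(X, E)) :
    Integrable f μ := by
  obtain ⟨C, hC⟩ := (isCompact_range (map_continuous f).norm).bddAbove
  exact Integrable.of_bound (map_continuous f).aestronglyMeasurable C
    (Filter.Eventually.of_forall fun x => hC ⟨x, rfl⟩)

/-- Two regular probability measures on a compact Hausdorff space with the same integrals of
continuous complex functions agree. -/
lemma regularProb_ext [T2Space X] {μ ν : ProbabilityMeasure X} (hμ : μ ∈ regularProb X)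
    (hν : ν ∈ regularProb X)
    (h : ∀ f : C(X, ℂ), ∫ x, f x ∂(μ : Measure X) = ∫ x, f x ∂(ν : Measure X)) : μ = ν := by
  have : (μ : Measure X).Regular := hμ
  have : (ν : Measure X).Regular := hν
  refine Subtype.ext <| show (μ : Measure X) = (ν : Measure X) from
    Measure.ext_of_integral_eq_on_compactlySupported fun f => ?_
  have := h ⟨fun x => (f x : ℂ), by fun_prop⟩
  simpa only [ContinuousMap.coe_mk, integral_complex_ofReal, Complex.ofReal_inj] using this

omit [CompactSpace X] in
lemma diracProba_mem_regularProb [T2Space X] (x : X) : diracProba x ∈ regularProb X := by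
  have : (Measure.dirac x).InnerRegular := by
    refine ⟨fun s hs r hr => ?_⟩
    rw [Measure.dirac_apply' _ hs] at hr
    by_cases hx : x ∈ s
    · refine ⟨{x}, by simpa using hx, isCompact_singleton, ?_⟩
      simpa [hx] using hr
    · simp [hx] at hr
  exact inferInstanceAs (Measure.dirac x).Regular

/-- Averages of regular probability measures: a regular probability measure dominating half of
each of two given ones. -/
lemma exists_regularProb_average [T2Space X] {μ ν : ProbabilityMeasure X}
    (hμ : μ ∈ regularProb X) (hν : ν ∈ regularProb X) :
    ∃ ρ ∈ regularProb X, ∀ f : C(X, ℝ), 2 * ∫ x, f x ∂(ρ : Measure X) =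
      ∫ x, f x ∂(μ : Measure X) + ∫ x, f x ∂(ν : Measure X) := by
  have : (μ : Measure X).Regular := hμ
  have : (ν : Measure X).Regular := hν
  let m : Measure X := (2⁻¹ : ℝ≥0∞) • ((μ : Measure X) + (ν : Measure X))
  have hm : IsProbabilityMeasure m := ⟨by
    simp [m, ENNReal.inv_two_add_inv_two]⟩
  have : ((μ : Measure X) + (ν : Measure X)).Regular := inferInstance
  refine ⟨⟨m, hm⟩, (inferInstance : m.Regular), fun f => ?_⟩
  have : ∫ x, f x ∂m = 2⁻¹ * (∫ x, f x ∂(μ : Measure X) + ∫ x, f x ∂(ν : Measure X)) := by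
    simp only [m]
    rw [integral_smul_measure, integral_add_measure (integrable_continuousMap _ f)
      (integrable_continuousMap _ f)]
    simp
  simp only [ProbabilityMeasure.coe_mk, this]
  ring

/-- A multiplicative regular probability measure is a point mass. -/
lemma exists_eq_diracProba_of_multiplicative [T2Space X] {ν : ProbabilityMeasure X}
    (hν : ν ∈ regularProb X)
    (h : ∀ f g : C(X, ℂ), ∫ x, (f * g) x ∂(ν : Measure X) =
      (∫ x, f x ∂(ν : Measure X)) * ∫ x, g x ∂(ν : Measure X)) :
    ∃ x : X, ν = diracProba x := by
  let L : C(X, ℂ) →ₗ[ℂ] ℂ :=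
    { toFun f := ∫ x, f x ∂(ν : Measure X)
      map_add' f g := integral_add (integrable_continuousMap _ f) (integrable_continuousMap _ g)
      map_smul' c f := integral_const_mul c f }
  let Λ : C(X, ℂ) →L[ℂ] ℂ := L.mkContinuous 1 fun f => by
    simpa [L] using norm_integral_le_of_norm_le_const (μ := (ν : Measure X)) (C := ‖f‖)
      (Filter.Eventually.of_forall fun x => f.norm_coe_le_norm x)
  have hΛ : ∀ f, Λ f = ∫ x, f x ∂(ν : Measure X) := fun _ => rfl
  -- Integration is a character of `C(X)`, and every such character is a point evaluation.
  let φ : WeakDual.characterSpace ℂ C(X, ℂ) := ⟨StrongDual.toWeakDual Λ, by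
    rw [WeakDual.CharacterSpace.eq_set_map_one_map_mul]
    refine ⟨?_, fun f g => h f g⟩
    change Λ 1 = 1
    simp [hΛ]⟩
  obtain ⟨x, hx⟩ := (WeakDual.CharacterSpace.continuousMapEval_bijective X ℂ).2 φ
  refine ⟨x, regularProb_ext hν (diracProba_mem_regularProb x) fun f => ?_⟩
  have h1 : f x = ∫ y, f y ∂(ν : Measure X) :=
    congrArg (fun ψ : WeakDual.characterSpace ℂ C(X, ℂ) => ψ f) hx
  rw [← h1]
  exact (integral_dirac' (f : X → ℂ) x (map_continuous f).stronglyMeasurable).symm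

end Measures

/-! ### Contractive unital functionals as measures -/

section States

/-- A contractive linear functional `Λ` on `C(X)` with `Λ 1 = 1` is integration against a regular
probability measure. -/
lemma exists_regularProb_of_contractive {X : Type v} [TopologicalSpace X] [CompactSpace X]
    [T2Space X] [MeasurableSpace X] [BorelSpace X] (Λ : C(X, ℂ) →ₗ[ℂ] ℂ)
    (hnorm : ∀ f, ‖Λ f‖ ≤ ‖f‖) (hone : Λ 1 = 1) :
    ∃ ν ∈ regularProb X, ∀ f, Λ f = ∫ x, f x ∂(ν : Measure X) := by
  let ι : C(X, ℝ) → C(X, ℂ) := fun f => ⟨fun x => (f x : ℂ), by fun_prop⟩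
  -- Since `f` is real, adding the imaginary constant `t * I` gives a function of norm at most
  -- `√(‖f‖² + t²)`. Expanding the square leaves a bound on `2 * Im Λ(f) * t` uniform in `t`, which
  -- forces the imaginary part to vanish.
  have hbound : ∀ (f : C(X, ℝ)) (t : ℝ), ‖Λ (ι f) + t * Complex.I‖ ^ 2 ≤ ‖f‖ ^ 2 + t ^ 2 := by
    intro f t
    have h1 : Λ (ι f) + t * Complex.I = Λ (ι f + ((t : ℂ) * Complex.I) • 1) := by
      rw [map_add, map_smul, hone]; simp
    have h2 : ‖ι f + ((t : ℂ) * Complex.I) • (1 : C(X, ℂ))‖ ≤ √(‖f‖ ^ 2 + t ^ 2) := by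
      rw [ContinuousMap.norm_le _ (Real.sqrt_nonneg _)]
      intro x
      have h3 : (ι f + ((t : ℂ) * Complex.I) • (1 : C(X, ℂ))) x = (f x : ℂ) + t * Complex.I := by
        simp [ι]
      rw [h3, Complex.norm_add_mul_I]
      apply Real.sqrt_le_sqrt
      have := f.norm_coe_le_norm x
      rw [Real.norm_eq_abs] at this
      have := sq_le_sq' (neg_le_of_abs_le this) (le_of_abs_le this)
      linarith
    rw [h1]
    refine (pow_le_pow_left₀ (norm_nonneg _) ((hnorm _).trans h2) 2).trans_eq ?_
    rw [Real.sq_sqrt (by positivity)]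
  have him : ∀ f : C(X, ℝ), (Λ (ι f)).im = 0 := by
    intro f
    by_contra hne
    have key : ∀ t : ℝ, 2 * (Λ (ι f)).im * t ≤ ‖f‖ ^ 2 := by
      intro t
      have := hbound f t
      rw [← Complex.normSq_eq_norm_sq, Complex.normSq_apply] at this
      simp at this
      nlinarith [sq_nonneg (Λ (ι f)).re, sq_nonneg (Λ (ι f)).im]
    -- This `t` turns the left side into `‖f‖ ^ 2 + 1`.
    have := key ((‖f‖ ^ 2 + 1) / (2 * (Λ (ι f)).im))
    rw [mul_div_cancel₀ _ (by simpa using hne)] at this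
    linarith
  have hreal : ∀ f : C(X, ℝ), Λ (ι f) = ((Λ (ι f)).re : ℂ) := fun f =>
    Complex.ext (by simp) (by simp [him f])
  have hpos : ∀ f : C(X, ℝ), (∀ x, 0 ≤ f x) → 0 ≤ (Λ (ι f)).re := by
    intro f hf
    -- For `0 ≤ f` the function `‖f‖ - f` has norm at most `‖f‖`, so contractivity gives `‖f‖ - Re
    -- Λ(f) ≤ ‖f‖`.
    have h1 : Λ ((‖f‖ : ℂ) • 1 - ι f) = ‖f‖ - Λ (ι f) := by
      rw [map_sub, map_smul, hone]; simp
    have h2 : ‖(‖f‖ : ℂ) • (1 : C(X, ℂ)) - ι f‖ ≤ ‖f‖ := by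
      rw [ContinuousMap.norm_le _ (norm_nonneg _)]
      intro x
      have h3 : ((‖f‖ : ℂ) • (1 : C(X, ℂ)) - ι f) x = ((‖f‖ - f x : ℝ) : ℂ) := by simp [ι]
      have := f.norm_coe_le_norm x
      rw [Real.norm_eq_abs] at this
      rw [h3, Complex.norm_real, Real.norm_eq_abs, abs_of_nonneg (by linarith [le_of_abs_le this])]
      linarith [hf x]
    have h4 := (Complex.re_le_norm _).trans ((hnorm _).trans h2)
    rw [h1] at h4
    simp at h4
    exact h4
  let M : C_c(X, ℝ) →ₗ[ℝ] ℝ :=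
    { toFun f := (Λ (ι f.toContinuousMap)).re
      map_add' f g := by
        have : ι (f + g).toContinuousMap = ι f.toContinuousMap + ι g.toContinuousMap := by
          ext x; simp [ι]
        rw [this, map_add, Complex.add_re]
      map_smul' c f := by
        have : ι (c • f).toContinuousMap = (c : ℂ) • ι f.toContinuousMap := by
          ext x; simp [ι]
        rw [this, map_smul]
        simp }
  let P : C_c(X, ℝ) →ₚ[ℝ] ℝ := PositiveLinearMap.mk₀ M fun f hf => hpos _ fun x => hf x
  have hint : ∀ f : C(X, ℝ), ∫ x, f x ∂(RealRMK.rieszMeasure P) = (Λ (ι f)).re := fun f =>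
    RealRMK.integral_rieszMeasure P ⟨f, HasCompactSupport.of_compactSpace _⟩
  have hprob : IsProbabilityMeasure (RealRMK.rieszMeasure P) := by
    have h1 := hint 1
    have h2 : ι 1 = 1 := by ext x; simp [ι]
    rw [h2, hone] at h1
    exact ⟨by simpa [Measure.real, ENNReal.toReal_eq_one_iff] using h1⟩
  refine ⟨⟨RealRMK.rieszMeasure P, hprob⟩, RealRMK.regular_rieszMeasure P, fun f => ?_⟩
  let a : C(X, ℝ) := ⟨fun x => (f x).re, by fun_prop⟩
  let b : C(X, ℝ) := ⟨fun x => (f x).im, by fun_prop⟩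
  have hf : f = ι a + Complex.I • ι b := by
    ext x
    simp [ι, a, b, mul_comm Complex.I]
  have h1 : ∀ g : C(X, ℝ), Λ (ι g) = ∫ x, ι g x ∂(RealRMK.rieszMeasure P) := by
    intro g
    rw [hreal, ← hint]
    exact integral_complex_ofReal.symm
  change Λ f = ∫ x, f x ∂(RealRMK.rieszMeasure P)
  rw [hf, map_add, map_smul, h1, h1, smul_eq_mul, ← integral_const_mul,
    ← integral_add (integrable_continuousMap _ _) ((integrable_continuousMap _ _).const_mul _)]
  rfl

end States

/-! ### Poisson maps on a boundary -/

section Boundary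

variable {G : Type u} [Group G] {X : Type v} [TopologicalSpace X] [CompactSpace X] [T2Space X]
  [MeasurableSpace X] [BorelSpace X] [MulAction G X] [ContinuousConstSMul G X]

omit [T2Space X] in
/-- Translates of a regular probability measure on a boundary concentrate at any given point. -/
lemma IsBoundary.exists_integral_lt (hX : IsBoundary G X) {ν : ProbabilityMeasure X}
    (hν : ν ∈ regularProb X) (h : C(X, ℝ)) (x : X) {ε : ℝ} (hε : h x < ε) :
    ∃ s : G, ∫ y, h (s • y) ∂(ν : Measure X) < ε := by
  obtain ⟨x₀, hx₀⟩ := hX.stronglyProximal ν hν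
  -- Strong proximality only yields some limit point mass at `x₀`; minimality then moves `x₀` by `t`
  -- into the open set where `h < ε`.
  obtain ⟨_, ⟨t, rfl⟩, hz⟩ := (hX.minimal x₀).exists_mem_open
    (isOpen_lt (map_continuous h) continuous_const) ⟨x, hε⟩
  let k : C(X, ℝ) := ⟨fun y => h (t • y), by fun_prop⟩
  have hopen : IsOpen {ρ : ProbabilityMeasure X | ∫ y, k y ∂(ρ : Measure X) < ε} :=
    isOpen_lt (ProbabilityMeasure.continuous_integral_continuousMap k) continuous_const
  have hmem : diracProba x₀ ∈ {ρ : ProbabilityMeasure X | ∫ y, k y ∂(ρ : Measure X) < ε} := by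
    change ∫ y, k y ∂(Measure.dirac x₀) < ε
    rw [integral_dirac' _ _ (map_continuous k).stronglyMeasurable]
    exact hz
  obtain ⟨_, hρ, s, rfl⟩ := mem_closure_iff.1 hx₀ _ hopen hmem
  refine ⟨t * s, ?_⟩
  change ∫ y, k y ∂((ν : Measure X).map fun x => s • x) < ε at hρ
  rw [integral_map (continuous_const_smul s).measurable.aemeasurable
    (map_continuous k).aestronglyMeasurable] at hρ
  simpa [k, mul_smul] using hρ

omit [T2Space X] [ContinuousConstSMul G X] [BorelSpace X] in
lemma poissonMap_apply (ν : ProbabilityMeasure X) (f : C(X, ℂ)) (s : G) :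
    poissonMap ν f s = ∫ x, f (s • x) ∂(ν : Measure X) := rfl

omit [T2Space X] in
lemma norm_poissonMap_sub_le (ν : ProbabilityMeasure X) (f : C(X, ℂ)) (x : X) (s : G) :
    ‖poissonMap ν f s - f x‖ ≤ ∫ y, ‖f (s • y) - f x‖ ∂(ν : Measure X) := by
  have h : Integrable (fun y => f (s • y)) (ν : Measure X) :=
    integrable_continuousMap _ (⟨fun y => f (s • y), by fun_prop⟩ : C(X, ℂ))
  have : poissonMap ν f s - f x = ∫ y, (f (s • y) - f x) ∂(ν : Measure X) := by
    rw [integral_sub h (integrable_const _), poissonMap_apply]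
    simp
  rw [this]
  exact norm_integral_le_integral_norm _

/-- Given two regular probability measures on a boundary, finitely many continuous functions and a
point `x`, a single group element makes all Poisson transforms close to the values at `x`. -/
lemma IsBoundary.exists_poissonMap_close (hX : IsBoundary G X) {μ ν : ProbabilityMeasure X}
    (hμ : μ ∈ regularProb X) (hν : ν ∈ regularProb X) (F : Finset C(X, ℂ)) (x : X) {ε : ℝ}
    (hε : 0 < ε) :
    ∃ s : G, ∀ f ∈ F, ‖poissonMap μ f s - f x‖ < ε ∧ ‖poissonMap ν f s - f x‖ < ε := by
  -- Concentrating the average concentrates both measures: `h` is nonnegative, so each integral is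
  -- at most their sum, which is twice the integral against `ρ`. Hence the bound `ε / 2`.
  obtain ⟨ρ, hρ, hρi⟩ := exists_regularProb_average hμ hν
  let h : C(X, ℝ) := ⟨fun y => ∑ f ∈ F, ‖f y - f x‖, by fun_prop⟩
  obtain ⟨s, hs⟩ := hX.exists_integral_lt hρ h x (ε := ε / 2) (by simpa [h] using hε)
  let hs' : C(X, ℝ) := ⟨fun y => h (s • y), by fun_prop⟩
  have hsum : ∫ y, hs' y ∂(μ : Measure X) + ∫ y, hs' y ∂(ν : Measure X) < ε := by
    rw [← hρi]
    change ∫ y, hs' y ∂(ρ : Measure X) < ε / 2 at hs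
    linarith
  have hnn : ∀ y, 0 ≤ hs' y := fun y => Finset.sum_nonneg fun f _ => norm_nonneg _
  refine ⟨s, fun f hf => ?_⟩
  have hle : ∀ τ : ProbabilityMeasure X,
      ‖poissonMap τ f s - f x‖ ≤ ∫ y, hs' y ∂(τ : Measure X) := fun τ =>
    (norm_poissonMap_sub_le τ f x s).trans <| integral_mono
      (integrable_continuousMap _ (⟨fun y => ‖f (s • y) - f x‖, by fun_prop⟩ : C(X, ℝ)))
      (integrable_continuousMap _ hs')
      fun y => Finset.single_le_sum (f := fun f : C(X, ℂ) => ‖f (s • y) - f x‖)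
        (fun _ _ => norm_nonneg _) hf
  have h1 := integral_nonneg (μ := (μ : Measure X)) (f := hs') hnn
  have h2 := integral_nonneg (μ := (ν : Measure X)) (f := hs') hnn
  exact ⟨by linarith [hle μ], by linarith [hle ν]⟩

/-- The Poisson map of a regular probability measure on a boundary, as a linear isometry. -/
noncomputable def poissonIsometry (hX : IsBoundary G X) {ν : ProbabilityMeasure X} (hν : ν ∈ regularProb X) :
    C(X, ℂ) →ₗᵢ[ℂ] LInf G where
  toFun := poissonMap ν
  map_add' f g := by
    ext s
    exact integral_add
      (integrable_continuousMap _ (⟨fun y => f (s • y), by fun_prop⟩ : C(X, ℂ)))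
      (integrable_continuousMap _ (⟨fun y => g (s • y), by fun_prop⟩ : C(X, ℂ)))
  map_smul' c f := by
    ext s
    exact integral_const_mul c _
  norm_map' f := by
    change ‖(poissonMap ν f : LInf G)‖ = ‖f‖
    apply le_antisymm
    · refine lp.norm_le_of_forall_le (norm_nonneg _) fun s => ?_
      simpa [poissonMap_apply] using
        norm_integral_le_of_norm_le_const (μ := (ν : Measure X)) (C := ‖f‖)
          (Filter.Eventually.of_forall fun x => f.norm_coe_le_norm (s • x))
    · refine (ContinuousMap.norm_le _ (norm_nonneg _)).2 fun x => le_of_forall_pos_le_add ?_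
      intro ε hε
      obtain ⟨s, hs⟩ := hX.exists_poissonMap_close hν hν {f} x hε
      have h1 := (hs f (by simp)).1
      have h2 := lp.norm_apply_le_norm ENNReal.top_ne_zero (poissonMap ν f : LInf G) s
      have h3 := norm_sub_norm_le (f x) (poissonMap ν f s)
      rw [norm_sub_rev] at h3
      linarith

omit [T2Space X] [BorelSpace X] in
lemma poissonMap_translateC (ν : ProbabilityMeasure X) (s : G) (f : C(X, ℂ)) :
    poissonMap ν (translateC s f) = translateLInf s (poissonMap ν f) := by
  ext t
  change ∫ x, f (s⁻¹ • t • x) ∂(ν : Measure X) = ∫ x, f ((s⁻¹ * t) • x) ∂(ν : Measure X)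
  simp only [mul_smul]

/-- Regular probability measures on a boundary are determined by the ranges of their Poisson
maps. -/
lemma IsBoundary.injOn_range_poissonMap (hX : IsBoundary G X) :
    Set.InjOn (fun ν : ProbabilityMeasure X => Set.range (poissonMap ν : C(X, ℂ) → LInf G))
      (regularProb X) := by
  classical
  intro μ hμ ν hν hμν
  refine regularProb_ext hμ hν fun f => ?_
  obtain ⟨g, hg⟩ : (poissonMap μ f : LInf G) ∈ Set.range (poissonMap ν : C(X, ℂ) → LInf G) :=
    hμν.subset ⟨f, rfl⟩
  -- At a suitable `s`, the common value of `P_μ f` and `P_ν g` is close to both `f x` and `g x`.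
  have hfg : f = g := by
    ext x
    refine eq_of_forall_dist_le fun ε hε => ?_
    obtain ⟨s, hs⟩ := hX.exists_poissonMap_close hμ hν {f, g} x (half_pos hε)
    have h1 := (hs f (by simp)).1
    have h2 := (hs g (by simp)).2
    rw [hg, ← dist_eq_norm] at h2
    rw [← dist_eq_norm, dist_comm] at h1
    linarith [dist_triangle (f x) (poissonMap μ f s) (g x)]
  subst hfg
  have := congrArg (fun φ : LInf G => φ 1) hg
  simpa [poissonMap_apply] using this.symm

/-- Every isometric equivariant linear map `C(X) → ℓ^∞(G)` has the same range as a Poisson map. -/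
lemma exists_range_poissonMap_eq [Nonempty X] (ψ : C(X, ℂ) →ₗᵢ[ℂ] LInf G)
    (hψ : ∀ (s : G) (f : C(X, ℂ)), ψ (translateC s f) = translateLInf s (ψ f)) :
    ∃ ν ∈ regularProb X, Set.range (poissonMap ν : C(X, ℂ) → LInf G) = Set.range ψ := by
  have happ : ∀ (f : C(X, ℂ)) (s : G), ψ f s = ψ (translateC s⁻¹ f) 1 := by
    intro f s
    rw [hψ]
    change ψ f s = ψ f (s⁻¹⁻¹ * 1)
    simp
  -- `ψ` need not be unital, but `ψ 1` is invariant, hence a constant `c` of modulus one.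
  set c : ℂ := ψ 1 1 with hc
  have hconst : ∀ s, ψ 1 s = c := by
    intro s
    rw [happ]
    rfl
  have hcnorm : ‖c‖ = 1 := by
    have h1 : ‖ψ 1‖ = 1 := by rw [ψ.norm_map, norm_one]
    have : ‖ψ 1‖ = ‖c‖ := by
      rw [lp.norm_eq_ciSup]
      simp [hconst]
    rw [← this, h1]
  have hc0 : c ≠ 0 := by
    rw [← norm_ne_zero_iff, hcnorm]
    exact one_ne_zero
  let Λ : C(X, ℂ) →ₗ[ℂ] ℂ :=
    { toFun f := c⁻¹ * ψ f 1
      map_add' f g := by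
        rw [map_add]
        exact mul_add _ _ _
      map_smul' a f := by
        rw [map_smul]
        exact mul_left_comm _ _ _ }
  obtain ⟨ν, hν, hΛ⟩ := exists_regularProb_of_contractive Λ
    (fun f => by
      change ‖c⁻¹ * ψ f 1‖ ≤ ‖f‖
      rw [norm_mul, norm_inv, hcnorm, inv_one, one_mul, ← ψ.norm_map f]
      exact lp.norm_apply_le_norm ENNReal.top_ne_zero _ _)
    (inv_mul_cancel₀ hc0)
  have hP : ∀ f, ψ f = c • poissonMap ν f := by
    intro f
    ext s
    rw [happ]
    change _ = c * ∫ x, f (s • x) ∂(ν : Measure X)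
    have h1 : c⁻¹ * ψ (translateC s⁻¹ f) 1 = ∫ x, f (s⁻¹⁻¹ • x) ∂(ν : Measure X) := hΛ _
    rw [inv_inv] at h1
    rw [← h1, mul_inv_cancel_left₀ hc0]
  refine ⟨ν, hν, ?_⟩
  ext φ
  constructor
  · rintro ⟨f, rfl⟩
    refine ⟨c⁻¹ • f, ?_⟩
    rw [map_smul, hP, inv_smul_smul₀ hc0]
  · rintro ⟨f, rfl⟩
    refine ⟨c • f, ?_⟩
    rw [hP]
    ext s
    exact integral_const_mul c _

/-- The range of the Poisson map of a point mass is a C*-subalgebra. -/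
lemma IsBoundary.isCStarSubalgebra_range_poissonMap_diracProba (hX : IsBoundary G X) (x : X) :
    IsCStarSubalgebra (Set.range (poissonMap (diracProba x) : C(X, ℂ) → LInf G)) := by
  have happ : ∀ (f : C(X, ℂ)) (s : G), poissonMap (diracProba x) f s = f (s • x) := fun f s =>
    integral_dirac' (fun y => f (s • y)) x
      ((map_continuous f).comp (continuous_const_smul s)).stronglyMeasurable
  let P := poissonIsometry hX (diracProba_mem_regularProb x)
  let A : NonUnitalStarSubalgebra ℂ (LInf G) :=
    { carrier := Set.range P
      add_mem' := by
        rintro _ _ ⟨f, rfl⟩ ⟨g, rfl⟩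
        exact ⟨f + g, map_add _ _ _⟩
      zero_mem' := ⟨0, map_zero _⟩
      smul_mem' := by
        rintro c _ ⟨f, rfl⟩
        exact ⟨c • f, map_smul _ _ _⟩
      mul_mem' := by
        rintro _ _ ⟨f, rfl⟩ ⟨g, rfl⟩
        refine ⟨f * g, ?_⟩
        ext s
        change poissonMap (diracProba x) (f * g) s =
          poissonMap (diracProba x) f s * poissonMap (diracProba x) g s
        simp only [happ, ContinuousMap.mul_apply]
      star_mem' := by
        rintro _ ⟨f, rfl⟩
        refine ⟨star f, ?_⟩
        ext s
        change poissonMap (diracProba x) (star f) s = star (poissonMap (diracProba x) f s)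
        simp only [happ, ContinuousMap.star_apply] }
  -- The isometric image of a complete space is closed.
  exact ⟨A, P.isometry.isClosedEmbedding.isClosed_range, rfl⟩

/-- If the range of a Poisson map on a boundary is closed under multiplication, then the measure
is multiplicative. -/
lemma IsBoundary.integral_mul_of_isCStarSubalgebra (hX : IsBoundary G X)
    {ν : ProbabilityMeasure X} (hν : ν ∈ regularProb X)
    (hA : IsCStarSubalgebra (Set.range (poissonMap ν : C(X, ℂ) → LInf G))) (f g : C(X, ℂ)) :
    ∫ x, (f * g) x ∂(ν : Measure X) =
      (∫ x, f x ∂(ν : Measure X)) * ∫ x, g x ∂(ν : Measure X) := by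
  classical
  obtain ⟨A, -, hA⟩ := hA
  have hmem : ∀ k : C(X, ℂ), (poissonMap ν k : LInf G) ∈ A := fun k => by
    rw [← SetLike.mem_coe, hA]
    exact ⟨k, rfl⟩
  have hprod := A.mul_mem (hmem f) (hmem g)
  obtain ⟨h, hh⟩ := hA.subset hprod
  have happ : ∀ s : G, poissonMap ν h s = poissonMap ν f s * poissonMap ν g s := fun s =>
    congrArg (fun φ : LInf G => φ s) hh
  have hfg : h = f * g := by
    ext x
    -- A sequence of group elements along which the Poisson transforms of `f`, `g` and `h` tend to
    -- their values at `x`; the product identity passes to the limit.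
    have hex : ∀ n : ℕ, ∃ s : G, ∀ k ∈ ({f, g, h} : Finset C(X, ℂ)),
        ‖poissonMap ν k s - k x‖ < 1 / ((n : ℝ) + 1) := fun n => by
      obtain ⟨s, hs⟩ := hX.exists_poissonMap_close hν hν {f, g, h} x
        (ε := 1 / ((n : ℝ) + 1)) (by positivity)
      exact ⟨s, fun k hk => (hs k hk).1⟩
    choose s hs using hex
    have hlim : ∀ k ∈ ({f, g, h} : Finset C(X, ℂ)),
        Filter.Tendsto (fun n => poissonMap ν k (s n)) Filter.atTop (𝓝 (k x)) := fun k hk =>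
      tendsto_iff_norm_sub_tendsto_zero.2 <| squeeze_zero (fun _ => norm_nonneg _)
        (fun n => (hs n k hk).le) tendsto_one_div_add_atTop_nhds_zero_nat
    have h1 := hlim h (by simp)
    simp only [happ] at h1
    exact tendsto_nhds_unique h1 ((hlim f (by simp)).mul (hlim g (by simp)))
  -- At the identity of `G` the Poisson transform is the integral itself.
  have := happ 1
  rw [hfg] at this
  simpa only [poissonMap_apply, one_smul] using this

end Boundary

end FurstenbergCopies

theorem mainTheorem11 (G : Type u) [Group G] (X : Type v) [TopologicalSpace X] [CompactSpace X]
    [T2Space X] [MeasurableSpace X] [BorelSpace X] [MulAction G X] [ContinuousConstSMul G X]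
    (hX : FurstenbergCopies.IsFurstenbergBoundary G X) :
    Set.BijOn
        (fun ν : ProbabilityMeasure X =>
          Set.range (FurstenbergCopies.poissonMap ν : C(X, ℂ) → FurstenbergCopies.LInf G))
        (FurstenbergCopies.regularProb X)
        {S : Set (FurstenbergCopies.LInf G) |
          FurstenbergCopies.IsEquivariantCopy (G := G) (X := X) S} ∧
      ∀ ν ∈ FurstenbergCopies.regularProb X,
        FurstenbergCopies.IsCStarSubalgebra
            (Set.range (FurstenbergCopies.poissonMap ν : C(X, ℂ) → FurstenbergCopies.LInf G)) ↔
          ∃ x : X, ν = diracProba x := by 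
  have hB := hX.isBoundary
  have := hB.nonempty
  refine ⟨⟨fun ν hν => ?_, hB.injOn_range_poissonMap, ?_⟩, fun ν hν => ⟨fun hA => ?_, ?_⟩⟩
  · exact ⟨FurstenbergCopies.poissonIsometry hB hν,
      FurstenbergCopies.poissonMap_translateC ν, rfl⟩
  · rintro _ ⟨ψ, hψ, rfl⟩
    exact FurstenbergCopies.exists_range_poissonMap_eq ψ hψ
  · exact FurstenbergCopies.exists_eq_diracProba_of_multiplicative hν
      (hB.integral_mul_of_isCStarSubalgebra hν hA)
  · rintro ⟨x, rfl⟩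
    exact hB.isCStarSubalgebra_range_poissonMap_diracProba x
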